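/- Let $0\le m\le n$ be integers. Let $G(n,m)$ be the Grassmannian of $m$-dimensional linear subspaces of $\mathbb{R}^n$, let $\gamma_{n,m}$ be its $O(n)$-invariant Borel probability measure, and for $V\in G(n,m)$ let $P_V:\mathbb{R}^n\to V$ be the orthogonal projection and $\mathcal H^m$ the $m$-dimensional Hausdorff measure on $V$, normalized to be Lebesgue measure. For Borel measures $\mu,\nu$ on $\mathbb{R}^n$ put $$I_m(\mu,\nu)=\iint |x-y|^{-m}\,d\mu(x)\,d\nu(y)\in[0,\infty],\qquad I_m(\mu)=I_m(\mu,\mu).$$ There is a constant $0<c<\infty$, depending only on $n$ and $m$, such that the following holds. Let $\mu,\nu$ be Borel measures on $\mathbb{R}^n$ with compact supports, with $0<\mu(\mathbb{R}^n)<\infty$, $0<\nu(\mathbb{R}^n)<\infty$, and with $I_m(\mu)<\infty$ and $I_m(\nu)<\infty$. Then for $\gamma_{n,m}$-almost every $V$ the image measures $P_{V\sharp}\mu$ and $P_{V\sharp}\nu$ are absolutely continuous with respect to $\mathcal H^m$ on $V$; denoting their Radon–Nikodym derivatives by the same symbols, the function $V\mapsto\int_V P_{V\sharp}\mu(v)\,P_{V\sharp}\nu(v)\,d\mathcal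 H^m(v)$ is $\gamma_{n,m}$-measurable, and $$0<\int_{G(n,m)}\int_V P_{V\sharp}\mu(v)\,P_{V\sharp}\nu(v)\,d\mathcal H^m(v)\,d\gamma_{n,m}(V)=c\,I_m(\mu,\nu)<\infty .$$ Moreover, $$\gamma_{n,m}\big(\{V\in G(n,m):\mathcal H^m(P_V(\operatorname{spt}\mu)\cap P_V(\operatorname{spt}\nu))>0\}\big)>0 .$$ -/

import Mathlib

open MeasureTheory Topology
open scoped ENNReal

namespace IntProj

/-- `ℝⁿ` with the Euclidean norm. -/
abbrev E (n : ℕ) : Type := EuclideanSpace ℝ (Fin n)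

/-- The Grassmannian `G(n, m)` of `m`-dimensional linear subspaces of `ℝⁿ`. -/
def Gr (n m : ℕ) : Type := {V : Submodule ℝ (E n) // Module.finrank ℝ V = m}

/-- The topology of `G(n, m)`, given by the metric `d(V, W) = ‖P_V - P_W‖` (operator norm). -/
noncomputable instance (n m : ℕ) : TopologicalSpace (Gr n m) :=
  TopologicalSpace.induced (fun V : Gr n m => V.1.starProjection) inferInstance

/-- `G(n, m)` carries its Borel `σ`-algebra. -/
noncomputable instance (n m : ℕ) : MeasurableSpace (Gr n m) := borel (Gr n m)

instance (n m : ℕ) : BorelSpace (Gr n m) := ⟨rfl⟩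

/-- The orthogonal group `O(n)`: the operators `g` on `ℝⁿ` with `g* g = g g* = 1`, with the
topology of the operator norm. -/
abbrev O (n : ℕ) : Type := unitary (E n →L[ℝ] E n)

instance (n : ℕ) : ContinuousStar (E n →L[ℝ] E n) :=
  ⟨(ContinuousLinearMap.adjoint (𝕜 := ℝ) (E := E n) (F := E n)).continuous⟩

instance (n : ℕ) : CompactSpace (O n) := by
  refine isCompact_iff_compactSpace.mp ?_
  have hp : ProperSpace (E n →L[ℝ] E n) := FiniteDimensional.proper ℝ _
  refine Metric.isCompact_of_isClosed_isBounded isClosed_unitary ?_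
  refine (Metric.isBounded_closedBall (x := (0 : E n →L[ℝ] E n)) (r := 1)).subset ?_
  intro g hg
  rw [mem_closedBall_zero_iff]
  refine ContinuousLinearMap.opNorm_le_bound _ zero_le_one fun x => ?_
  rw [one_mul]
  exact ((Unitary.linearIsometryEquiv ⟨g, hg⟩).norm_map x).le

/-- The Haar probability measure on `O(n)`. -/
noncomputable def haarO (n : ℕ) : Measure (O n) := Measure.haarMeasure ⊤

instance (n : ℕ) : IsProbabilityMeasure (haarO n) :=
  ⟨Measure.haarMeasure_self (K₀ := (⊤ : TopologicalSpace.PositiveCompacts (O n)))⟩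

/-- The action of `O(n)` on `G(n, m)`: the subspace `g V`. -/
noncomputable def rot {n m : ℕ} (g : O n) (V : Gr n m) : Gr n m :=
  ⟨V.1.map (Unitary.linearIsometryEquiv g).toLinearEquiv.toLinearMap,
    (LinearEquiv.finrank_map_eq _ _).trans V.2⟩

theorem starProjection_rot {n m : ℕ} (g : O n) (V : Gr n m) :
    (rot g V).1.starProjection
      = (g : E n →L[ℝ] E n) * V.1.starProjection * star (g : E n →L[ℝ] E n) := by
  ext1 x
  exact Submodule.starProjection_map_apply (Unitary.linearIsometryEquiv g) V.1 x

theorem continuous_rot {n m : ℕ} (V : Gr n m) : Continuous fun g : O n => rot g V := by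
  rw [continuous_induced_rng]
  simp only [Function.comp_def, starProjection_rot]
  fun_prop

/-- The coordinate plane spanned by the first `m` standard basis vectors of `ℝⁿ`. -/
noncomputable def coordPlane {n m : ℕ} (h : m ≤ n) : Gr n m :=
  ⟨Submodule.span ℝ (Set.range fun i : Fin m => EuclideanSpace.basisFun (Fin n) ℝ (Fin.castLE h i)),
    by
      exact (finrank_span_eq_card
        ((EuclideanSpace.basisFun (Fin n) ℝ).orthonormal.linearIndependent.comp
          _ (Fin.castLE_injective h))).trans (Fintype.card_fin m)⟩

/-- The Haar measure `γ_{n,m}` on `G(n, m)`: the `O(n)`-invariant Borel probability measure, that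
is, the distribution of `g V₀` for `g` Haar distributed on `O(n)` and `V₀` a fixed `m`-plane. -/
noncomputable def grMeasure {n m : ℕ} (h : m ≤ n) : Measure (Gr n m) :=
  (haarO n).map fun g => rot g (coordPlane h)

instance {n m : ℕ} (h : m ≤ n) : IsProbabilityMeasure (grMeasure h) :=
  Measure.isProbabilityMeasure_map (continuous_rot _).measurable.aemeasurable

/-- The class `𝓜(A)` of Borel measures with `0 < μ(A) < ∞` and compact support contained in `A`. -/
def MemM {n : ℕ} (A : Set (E n)) (μ : Measure (E n)) : Prop :=
  0 < μ A ∧ μ A < ∞ ∧ IsCompact μ.support ∧ μ.support ⊆ A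

/-- The mutual energy `I_s(μ, ν) = ∬ |x - y|^{-s} dμ(x) dν(y)` with values in `[0, ∞]`; for `s > 0`
the kernel is `∞` on the diagonal. -/
noncomputable def mutualEnergy {n : ℕ} (s : ℝ) (μ ν : Measure (E n)) : ℝ≥0∞ :=
  ∫⁻ y, ∫⁻ x, edist x y ^ (-s) ∂μ ∂ν

/-- The energy `I_s(μ) = I_s(μ, μ)`. -/
noncomputable def energy {n : ℕ} (s : ℝ) (μ : Measure (E n)) : ℝ≥0∞ := mutualEnergy s μ μ

/-- The orthogonal projection `P_V : ℝⁿ → V`. -/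
noncomputable def proj {n m : ℕ} (V : Gr n m) : E n →L[ℝ] V.1 := V.1.orthogonalProjectionOnto

/-- The image measure `P_{V♯} μ` on `V`. -/
noncomputable def projMeasure {n m : ℕ} (V : Gr n m) (μ : Measure (E n)) : Measure V.1 :=
  μ.map (proj V)

/-- The `m`-dimensional Hausdorff measure on the `m`-plane `V`, normalized to be Lebesgue measure. -/
noncomputable def hausV {n m : ℕ} (V : Gr n m) : Measure V.1 :=
  Measure.euclideanHausdorffMeasure m

/-- The Radon–Nikodym derivative of `P_{V♯} μ` with respect to the Hausdorff measure on `V`. -/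
noncomputable def projDensity {n m : ℕ} (V : Gr n m) (μ : Measure (E n)) : V.1 → ℝ≥0∞ :=
  (projMeasure V μ).rnDeriv (hausV V)

end IntProj

/-!
By differentiation of measures, the squared `L²` norm of the density of a finite measure `α` on an
`m`-plane is the limit, as `δ → 0`, of the `α`-average of `α(B(v, δ)) / |B(v, δ)|`: Fatou's lemma
gives one inequality, and `2 a b ≤ a² + b²` bounds the average for every fixed `δ`.

For `α = P_{V♯} μ`, integrating over `V` turns this average into the double integral of
`k_δ(x - y)` with `k_δ(z) = γ{V : |P_V z| ≤ δ} / |B(0, δ)|`. By rotation invariance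
`γ{V : |P_V z| ≤ δ}` is the proportion of the unit ball filled by the cone `|P x| ≤ (δ / |z|) |x|`
for a fixed plane. Stretching that cone along the plane by the factor `|z| / δ` shows that
`k_δ(z) = |z|⁻ᵐ κ(δ / |z|)`, where `κ` is bounded and has a limit at `0`. So the squared norms
integrate to `κ(0) I_m(μ)` if `I_m(μ) < ∞`, by dominated convergence.

If some `μ ≠ 0` has finite energy then `κ(0) > 0`, since a nonzero measure has no density of norm
zero. Fatou's lemma then gives `I_m(μ, ν) < ∞`, and the mutual formula follows by polarization. If
the projections of the supports meet in a null set, the product of the two densities vanishes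
almost everywhere.
-/

namespace IntProj

open Filter Metric

section DensityEnergy

variable {X : Type*} [MeasurableSpace X] {lam α β : Measure X}

/-- The squared `L²` norm of the density of `α` with respect to `lam`, infinite if `α` is not
absolutely continuous. Off the singular part of `α` the integrand `(d lam / d α)⁻¹` is
`d α / d lam`, and on the singular part it is `0⁻¹ = ∞`. -/
noncomputable def densityEnergy (lam α : Measure X) : ℝ≥0∞ :=
  ∫⁻ v, (lam.rnDeriv α v)⁻¹ ∂α

theorem absolutelyContinuous_of_densityEnergy_ne_top (h : densityEnergy lam α ≠ ∞) : α ≪ lam := by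
  have hne : ∀ᵐ v ∂α, lam.rnDeriv α v ≠ 0 := by
    filter_upwards [ae_lt_top (Measure.measurable_rnDeriv lam α).inv h] with v hv
    exact ENNReal.inv_ne_top.1 hv.ne
  exact (withDensity_absolutelyContinuous' (Measure.measurable_rnDeriv lam α).aemeasurable
    hne).trans (Measure.withDensity_rnDeriv_le lam α).absolutelyContinuous

theorem eq_zero_of_densityEnergy_eq_zero [SigmaFinite lam] (h : densityEnergy lam α = 0) :
    α = 0 := by
  replace h := (lintegral_eq_zero_iff (Measure.measurable_rnDeriv lam α).inv).1 h
  have hfalse : ∀ᵐ _ ∂α, False := by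
    filter_upwards [h, Measure.rnDeriv_lt_top lam α] with v hv hlt
    exact hlt.ne (ENNReal.inv_eq_zero.1 hv)
  rwa [eventually_false_iff_eq_bot, ae_eq_bot] at hfalse

theorem ae_rnDeriv_eq_zero_of_measure_compl_eq_zero {s : Set X} (hs : MeasurableSet s)
    (hα : α sᶜ = 0) : ∀ᵐ v ∂lam, v ∉ s → α.rnDeriv lam v = 0 := by
  have hint : ∫⁻ v in sᶜ, α.rnDeriv lam v ∂lam = 0 :=
    nonpos_iff_eq_zero.1 ((Measure.setLIntegral_rnDeriv_le _).trans hα.le)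
  exact (ae_restrict_iff' hs.compl).1
    ((lintegral_eq_zero_iff (Measure.measurable_rnDeriv _ _)).1 hint)

theorem lintegral_rnDeriv_mul_rnDeriv_eq_zero {s t : Set X} (hs : MeasurableSet s)
    (ht : MeasurableSet t) (hα : α sᶜ = 0) (hβ : β tᶜ = 0) (hst : lam (s ∩ t) = 0) :
    ∫⁻ v, α.rnDeriv lam v * β.rnDeriv lam v ∂lam = 0 := by
  refine (lintegral_congr_ae ?_).trans lintegral_zero
  filter_upwards [ae_rnDeriv_eq_zero_of_measure_compl_eq_zero hs hα,
    ae_rnDeriv_eq_zero_of_measure_compl_eq_zero ht hβ,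
    measure_eq_zero_iff_ae_notMem.1 hst] with v hvs hvt hv
  by_cases h : v ∈ s
  · rw [hvt fun h' => hv ⟨h, h'⟩, mul_zero]
  · rw [hvs h, zero_mul]

variable [SigmaFinite lam] [SigmaFinite α]

theorem densityEnergy_eq_lintegral_sq (hα : α ≪ lam) :
    densityEnergy lam α = ∫⁻ v, α.rnDeriv lam v ^ 2 ∂lam := by
  simp only [sq]
  rw [lintegral_rnDeriv_mul hα (Measure.measurable_rnDeriv α lam).aemeasurable]
  exact lintegral_congr_ae (Measure.inv_rnDeriv' hα)

theorem densityEnergy_add [SigmaFinite β] (hα : α ≪ lam) (hβ : β ≪ lam) :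
    densityEnergy lam (α + β) = densityEnergy lam α + densityEnergy lam β
      + 2 * ∫⁻ v, α.rnDeriv lam v * β.rnDeriv lam v ∂lam := by
  have hf : Measurable (α.rnDeriv lam) := Measure.measurable_rnDeriv _ _
  have hg : Measurable (β.rnDeriv lam) := Measure.measurable_rnDeriv _ _
  rw [densityEnergy_eq_lintegral_sq hα, densityEnergy_eq_lintegral_sq hβ,
    densityEnergy_eq_lintegral_sq (hα.add_left hβ),
    ← lintegral_const_mul _ (f := fun v => α.rnDeriv lam v * β.rnDeriv lam v) (hf.mul hg),
    ← lintegral_add_left (by fun_prop), ← lintegral_add_left (by fun_prop)]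
  refine lintegral_congr_ae ?_
  filter_upwards [Measure.rnDeriv_add' α β lam] with v hv
  rw [hv, Pi.add_apply]
  ring

end DensityEnergy

theorem two_mul_mul_le_sq_add_sq (a b : ℝ≥0∞) : 2 * (a * b) ≤ a ^ 2 + b ^ 2 := by
  rcases eq_or_ne a ∞ with rfl | ha
  · simp
  rcases eq_or_ne b ∞ with rfl | hb
  · simp
  lift a to NNReal using ha
  lift b to NNReal using hb
  norm_cast
  rw [← mul_assoc]
  exact two_mul_le_add_sq a b

section BallEnergy

variable {W : Type*} [PseudoMetricSpace W] [MeasurableSpace W]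

/-- The `β`-integral of the mean density of `α` in balls of radius `δ`: at scale `δ`, an
approximation of the `L²(lam)` inner product of the densities of `α` and `β`. -/
noncomputable def ballEnergy (lam : Measure W) (δ : ℝ) (α β : Measure W) : ℝ≥0∞ :=
  ∫⁻ v, α (closedBall v δ) / lam (closedBall v δ) ∂β

variable [SecondCountableTopology W] [BorelSpace W]

theorem measurableSet_dist_le (δ : ℝ) : MeasurableSet {p : W × W | dist p.2 p.1 ≤ δ} :=
  (isClosed_le (by fun_prop) continuous_const).measurableSet

theorem measurable_measure_closedBall (α : Measure W) [SFinite α] (δ : ℝ) :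
    Measurable fun v => α (closedBall v δ) :=
  measurable_measure_prodMk_left (measurableSet_dist_le δ)

variable {lam : Measure W} [SigmaFinite lam]

theorem lintegral_setLIntegral_closedBall (δ : ℝ) {f : W → ℝ≥0∞} (hf : Measurable f) :
    ∫⁻ v, ∫⁻ w in closedBall v δ, f w ∂lam ∂lam = ∫⁻ w, lam (closedBall w δ) * f w ∂lam := by
  have hswap : ∀ v w, (closedBall v δ).indicator f w = f w * (closedBall w δ).indicator 1 v := by
    intro v w
    simp only [Set.indicator, mem_closedBall, dist_comm w v, Pi.one_apply, mul_ite, mul_one,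
      mul_zero]
  have hmeas : Measurable fun p : W × W => (closedBall p.1 δ).indicator f p.2 :=
    (hf.comp measurable_snd).indicator (measurableSet_dist_le δ)
  calc ∫⁻ v, ∫⁻ w in closedBall v δ, f w ∂lam ∂lam
      = ∫⁻ v, ∫⁻ w, (closedBall v δ).indicator f w ∂lam ∂lam := by
        simp only [lintegral_indicator measurableSet_closedBall]
    _ = ∫⁻ w, ∫⁻ v, (closedBall v δ).indicator f w ∂lam ∂lam :=
        lintegral_lintegral_swap hmeas.aemeasurable
    _ = ∫⁻ w, lam (closedBall w δ) * f w ∂lam := by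
        refine lintegral_congr fun w => ?_
        simp only [hswap]
        rw [lintegral_const_mul _ (measurable_one.indicator measurableSet_closedBall),
          lintegral_indicator_one measurableSet_closedBall, mul_comm]

variable {α β : Measure W} [SigmaFinite α] [SigmaFinite β]

theorem two_mul_lintegral_measure_closedBall_le {δ : ℝ} {L : ℝ≥0∞}
    (hL : ∀ v, lam (closedBall v δ) = L) (hα : α ≪ lam) (hβ : β ≪ lam) :
    2 * ∫⁻ v, α (closedBall v δ) ∂β ≤ L * (densityEnergy lam α + densityEnergy lam β) := by
  set f := α.rnDeriv lam
  set g := β.rnDeriv lam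
  have hf : Measurable f := Measure.measurable_rnDeriv _ _
  have hg : Measurable g := Measure.measurable_rnDeriv _ _
  have hball := measurable_measure_closedBall α δ
  have hlball : ∀ v, α (closedBall v δ) = ∫⁻ w in closedBall v δ, f w ∂lam := fun v =>
    (Measure.setLIntegral_rnDeriv hα _).symm
  have hpoint : ∀ v, 2 * (g v * α (closedBall v δ))
      ≤ ∫⁻ w in closedBall v δ, f w ^ 2 ∂lam + L * g v ^ 2 := by
    intro v
    calc 2 * (g v * α (closedBall v δ))
        = ∫⁻ w in closedBall v δ, 2 * (f w * g v) ∂lam := by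
          rw [lintegral_const_mul _ (hf.mul_const _), lintegral_mul_const _ hf, ← hlball,
            mul_comm (g v)]
      _ ≤ ∫⁻ w in closedBall v δ, (f w ^ 2 + g v ^ 2) ∂lam :=
          lintegral_mono fun w => two_mul_mul_le_sq_add_sq _ _
      _ = ∫⁻ w in closedBall v δ, f w ^ 2 ∂lam + L * g v ^ 2 := by
          rw [lintegral_add_left (hf.pow_const 2), setLIntegral_const, hL, mul_comm L]
  calc 2 * ∫⁻ v, α (closedBall v δ) ∂β
      = ∫⁻ v, 2 * (g v * α (closedBall v δ)) ∂lam := by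
        rw [lintegral_const_mul _ (f := fun v => g v * α (closedBall v δ)) (hg.mul hball),
          lintegral_rnDeriv_mul hβ hball.aemeasurable]
    _ ≤ ∫⁻ v, (∫⁻ w in closedBall v δ, f w ^ 2 ∂lam + L * g v ^ 2) ∂lam := lintegral_mono hpoint
    _ = L * (densityEnergy lam α + densityEnergy lam β) := by
        rw [lintegral_add_right _ ((hg.pow_const 2).const_mul L),
          lintegral_setLIntegral_closedBall δ (hf.pow_const 2), densityEnergy_eq_lintegral_sq hα,
          densityEnergy_eq_lintegral_sq hβ, mul_add, lintegral_const_mul _ (hg.pow_const 2)]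
        simp only [hL]
        rw [lintegral_const_mul _ (hf.pow_const 2)]

theorem two_mul_ballEnergy_le {δ : ℝ} {L : ℝ≥0∞} (hL : ∀ v, lam (closedBall v δ) = L) :
    2 * ballEnergy lam δ α β ≤ densityEnergy lam α + densityEnergy lam β := by
  rcases eq_or_ne (densityEnergy lam α) ∞ with hα | hα
  · simp [hα]
  rcases eq_or_ne (densityEnergy lam β) ∞ with hβ | hβ
  · simp [hβ]
  simp only [ballEnergy, hL, div_eq_mul_inv]
  rw [lintegral_mul_const _ (measurable_measure_closedBall α δ), ← mul_assoc, ← div_eq_mul_inv]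
  exact ENNReal.div_le_of_le_mul' (two_mul_lintegral_measure_closedBall_le hL
    (absolutelyContinuous_of_densityEnergy_ne_top hα)
    (absolutelyContinuous_of_densityEnergy_ne_top hβ))

theorem ballEnergy_self_le {δ : ℝ} {L : ℝ≥0∞} (hL : ∀ v, lam (closedBall v δ) = L) :
    ballEnergy lam δ α α ≤ densityEnergy lam α := by
  have h := two_mul_ballEnergy_le (α := α) (β := α) hL
  rw [← two_mul] at h
  exact (ENNReal.mul_le_mul_iff_right two_ne_zero ENNReal.ofNat_ne_top).1 h

end BallEnergy

theorem densityEnergy_le_liminf_ballEnergy {W : Type*} [MetricSpace W] [SecondCountableTopology W]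
    [HasBesicovitchCovering W] [MeasurableSpace W] [BorelSpace W] (lam α : Measure W)
    [IsLocallyFiniteMeasure lam] [lam.IsOpenPosMeasure] [IsFiniteMeasure α] :
    densityEnergy lam α ≤ liminf (fun δ => ballEnergy lam δ α α) (𝓝[>] 0) := by
  refine le_trans (lintegral_mono_ae ?_) (lintegral_liminf_le fun δ =>
    (measurable_measure_closedBall α δ).div (measurable_measure_closedBall lam δ))
  filter_upwards [Besicovitch.ae_tendsto_rnDeriv lam α] with v hv
  refine ((hv.inv.congr' ?_).liminf_eq).ge
  filter_upwards [self_mem_nhdsWithin] with δ hδ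
  exact ENNReal.inv_div (.inl (measure_ne_top _ _)) (.inr (measure_closedBall_pos lam v hδ).ne')

theorem tendsto_ballEnergy {W : Type*} [NormedAddCommGroup W] [NormedSpace ℝ W]
    [FiniteDimensional ℝ W] [MeasurableSpace W] [BorelSpace W] (lam α : Measure W)
    [lam.IsAddHaarMeasure] [IsFiniteMeasure α] :
    Tendsto (fun δ => ballEnergy lam δ α α) (𝓝[>] 0) (𝓝 (densityEnergy lam α)) :=
  tendsto_of_le_liminf_of_limsup_le (densityEnergy_le_liminf_ballEnergy lam α)
    (limsup_le_of_le (by isBoundedDefault) (Eventually.of_forall fun δ =>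
      ballEnergy_self_le fun v => Measure.addHaar_closedBall_center lam v δ))

section Stretch

variable {F : Type*} [NormedAddCommGroup F] [InnerProductSpace ℝ F] (V : Submodule ℝ F)
  [V.HasOrthogonalProjection] (t : ℝ)

/-- The linear map which scales by `t` along `V` and is the identity on `Vᗮ`. -/
noncomputable def stretch : F →L[ℝ] F := t • V.starProjection + Vᗮ.starProjection

theorem stretch_apply (x : F) :
    stretch V t x = t • V.starProjection x + Vᗮ.starProjection x := rfl

theorem starProjection_stretch (x : F) :
    V.starProjection (stretch V t x) = t • V.starProjection x := by
  rw [stretch_apply, map_add, map_smul,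
    Submodule.starProjection_eq_self_iff.2 (V.starProjection_apply_mem x),
    (Submodule.starProjection_apply_eq_zero_iff _).2 (Vᗮ.starProjection_apply_mem x), add_zero]

theorem starProjection_orthogonal_stretch (x : F) :
    Vᗮ.starProjection (stretch V t x) = Vᗮ.starProjection x := by
  rw [Submodule.starProjection_orthogonal_val, starProjection_stretch, stretch_apply,
    add_sub_cancel_left]

theorem norm_starProjection_orthogonal_le (x : F) :
    ‖Vᗮ.starProjection x‖ ≤ ‖stretch V t x‖ := by
  rw [← starProjection_orthogonal_stretch V t x]
  exact Submodule.norm_starProjection_apply_le _ _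

theorem norm_stretch_zero_le (x : F) : ‖stretch V 0 x‖ ≤ ‖stretch V t x‖ := by
  rw [stretch_apply, zero_smul, zero_add]
  exact norm_starProjection_orthogonal_le V t x

theorem det_stretch [FiniteDimensional ℝ F] :
    LinearMap.det (stretch V t : F →ₗ[ℝ] F) = t ^ Module.finrank ℝ V := by
  have hV : ∀ x ∈ V, stretch V t x = t • x := by
    intro x hx
    rw [stretch_apply, Submodule.starProjection_eq_self_iff.2 hx,
      (Submodule.starProjection_apply_eq_zero_iff _).2 (V.le_orthogonal_orthogonal hx), add_zero]
  have hmaps : V ≤ V.comap (stretch V t : F →ₗ[ℝ] F) := fun x hx => by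
    rw [Submodule.mem_comap, ContinuousLinearMap.coe_coe, hV x hx]
    exact V.smul_mem t hx
  have hrestrict : (stretch V t : F →ₗ[ℝ] F).restrict hmaps = t • LinearMap.id :=
    LinearMap.ext fun x => Subtype.ext (hV x x.2)
  have hquot : V.mapQ V (stretch V t : F →ₗ[ℝ] F) hmaps = LinearMap.id := by
    refine Submodule.linearMap_qext _ (LinearMap.ext fun x => ?_)
    refine (Submodule.Quotient.eq V).2 ?_
    change stretch V t x - x ∈ V
    nth_rw 2 [← V.starProjection_add_starProjection_orthogonal x]
    rw [stretch_apply, add_sub_add_right_eq_sub]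
    exact V.sub_mem (V.smul_mem t (V.starProjection_apply_mem x)) (V.starProjection_apply_mem x)
  rw [LinearMap.det_eq_det_mul_det V _ hmaps, hrestrict, hquot, LinearMap.det_smul,
    LinearMap.det_id, LinearMap.det_id, mul_one, mul_one]

/-- The points `y` with `stretch V t y` in the open unit ball and `‖P_V y‖ ≤ ‖stretch V t y‖`: the
rescaling by `stretch V t` of the part of the narrow cone `‖P_V x‖ ≤ t ‖x‖` in that ball. -/
def stretchedCone : Set F :=
  {y | ‖V.starProjection y‖ ≤ ‖stretch V t y‖ ∧ ‖stretch V t y‖ < 1}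

theorem stretchedCone_subset_ball : stretchedCone V t ⊆ ball 0 2 := by
  rintro y ⟨hle, hlt⟩
  have hQ := norm_starProjection_orthogonal_le V t y
  rw [mem_ball_zero_iff, ← V.starProjection_add_starProjection_orthogonal y]
  calc ‖V.starProjection y + Vᗮ.starProjection y‖
      ≤ ‖V.starProjection y‖ + ‖Vᗮ.starProjection y‖ := norm_add_le _ _
    _ < 2 := by linarith

theorem preimage_stretch_cone_inter_ball {t : ℝ} (ht : 0 < t) :
    stretch V t ⁻¹' ({x | ‖V.starProjection x‖ ≤ t * ‖x‖} ∩ ball 0 1) = stretchedCone V t := by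
  ext y
  simp only [stretchedCone, Set.mem_preimage, Set.mem_inter_iff, Set.mem_ofPred_eq,
    mem_ball_zero_iff, starProjection_stretch, norm_smul, Real.norm_of_nonneg ht.le,
    mul_le_mul_iff_right₀ ht]

theorem eventually_mem_stretchedCone_iff (y : F) :
    ∀ᶠ t in 𝓝[>] (0 : ℝ), y ∈ stretchedCone V t ↔ y ∈ stretchedCone V 0 := by
  have hcont : Continuous fun t => ‖stretch V t y‖ := by
    simp only [stretch_apply]
    fun_prop
  have hlt (a : ℝ) : ∀ᶠ t in 𝓝[>] (0 : ℝ), ‖stretch V t y‖ < a ↔ ‖stretch V 0 y‖ < a := by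
    by_cases ha : ‖stretch V 0 y‖ < a
    · filter_upwards [(hcont.continuousWithinAt.eventually_lt continuousWithinAt_const ha)]
        with t ht using iff_of_true ht ha
    · exact Eventually.of_forall fun t =>
        iff_of_false (fun ht => ha ((norm_stretch_zero_le V t y).trans_lt ht)) ha
  filter_upwards [hlt ‖V.starProjection y‖, hlt 1] with t hcone hball
  exact and_congr (by rw [← not_lt, hcone, not_lt]) hball

variable [MeasurableSpace F] [BorelSpace F]

theorem measurableSet_stretchedCone : MeasurableSet (stretchedCone V t) :=
  (isClosed_le V.starProjection.continuous.norm (stretch V t).continuous.norm).measurableSet.inter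
    (isOpen_lt (stretch V t).continuous.norm continuous_const).measurableSet

variable [FiniteDimensional ℝ F]

theorem addHaar_cone_inter_ball (κ : Measure F) [κ.IsAddHaarMeasure] {t : ℝ} (ht : 0 < t) :
    κ ({x | ‖V.starProjection x‖ ≤ t * ‖x‖} ∩ ball 0 1)
      = ENNReal.ofReal (t ^ Module.finrank ℝ V) * κ (stretchedCone V t) := by
  have hdet := det_stretch V t
  have hpos : 0 < t ^ Module.finrank ℝ V := pow_pos ht _
  rw [← preimage_stretch_cone_inter_ball V ht, Measure.addHaar_preimage_continuousLinearMap κ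
    (hdet.trans_ne hpos.ne'), hdet, abs_of_pos (inv_pos.2 hpos), ← mul_assoc,
    ← ENNReal.ofReal_mul hpos.le, mul_inv_cancel₀ hpos.ne', ENNReal.ofReal_one, one_mul]

theorem tendsto_measure_stretchedCone (κ : Measure F) [IsFiniteMeasureOnCompacts κ] :
    Tendsto (fun t => κ (stretchedCone V t)) (𝓝[>] 0) (𝓝 (κ (stretchedCone V 0))) :=
  tendsto_measure_of_tendsto_indicator (𝓝[>] 0) (fun _ => measurableSet_stretchedCone V _)
    measurableSet_ball measure_ball_lt_top.ne
    (Eventually.of_forall (stretchedCone_subset_ball V)) (eventually_mem_stretchedCone_iff V)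

end Stretch

section OrthogonalGroup

variable {n : ℕ} {A : Set (E n)}

instance : (haarO n).IsMulLeftInvariant := by
  unfold haarO
  infer_instance

theorem measurableSet_star_apply_mem (hA : MeasurableSet A) :
    MeasurableSet {p : E n × O n | star (p.2 : E n →L[ℝ] E n) p.1 ∈ A} :=
  (by fun_prop : Continuous fun p : E n × O n => star (p.2 : E n →L[ℝ] E n) p.1).measurable hA

theorem haarO_star_apply_mem_congr_norm {z w : E n} (hzw : ‖z‖ = ‖w‖) :
    haarO n {g | star (g : E n →L[ℝ] E n) z ∈ A}
      = haarO n {g | star (g : E n →L[ℝ] E n) w ∈ A} := by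
  let R : O n := Unitary.linearIsometryEquiv.symm (Submodule.reflection (ℝ ∙ (z - w))ᗮ)
  have hR : (R : E n →L[ℝ] E n) z = w := Submodule.reflection_sub hzw
  rw [← measure_preimage_mul (haarO n) R {g | star (g : E n →L[ℝ] E n) w ∈ A}]
  congr 1 with g
  have hg : star ((R * g : O n) : E n →L[ℝ] E n) w = star (g : E n →L[ℝ] E n) z := by
    rw [Submonoid.coe_mul, star_mul, ← hR, ← mul_apply_eq_comp, mul_assoc,
      Unitary.coe_star_mul_self, mul_one]
  simp only [Set.mem_preimage, Set.mem_ofPred_eq, hg]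

theorem haarO_star_apply_mem_eq_of_cone (hcone : ∀ r : ℝ, 0 < r → ∀ x, r • x ∈ A ↔ x ∈ A)
    {z w : E n} (hz : z ≠ 0) (hw : w ≠ 0) :
    haarO n {g | star (g : E n →L[ℝ] E n) z ∈ A}
      = haarO n {g | star (g : E n →L[ℝ] E n) w ∈ A} := by
  have hr : 0 < ‖w‖ / ‖z‖ := div_pos (norm_pos_iff.2 hw) (norm_pos_iff.2 hz)
  have hnorm : ‖(‖w‖ / ‖z‖) • z‖ = ‖w‖ := by
    rw [norm_smul, Real.norm_of_nonneg hr.le, div_mul_cancel₀ _ (norm_ne_zero_iff.2 hz)]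
  rw [← haarO_star_apply_mem_congr_norm hnorm]
  simp only [map_smul, hcone _ hr]

theorem volume_restrict_ball_star_apply_mem (hA : MeasurableSet A) (g : O n) :
    volume.restrict (ball 0 1) {x | star (g : E n →L[ℝ] E n) x ∈ A} = volume (A ∩ ball 0 1) := by
  let e := Unitary.linearIsometryEquiv (star g)
  have hpreimage : {x | star (g : E n →L[ℝ] E n) x ∈ A} ∩ ball 0 1 = e ⁻¹' (A ∩ ball 0 1) := by
    ext x
    rw [Set.preimage_inter, e.preimage_ball, map_zero]
    rfl
  rw [Measure.restrict_apply' measurableSet_ball, hpreimage,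
    e.measurePreserving.measure_preimage (hA.inter measurableSet_ball).nullMeasurableSet]

theorem haarO_star_apply_mem_mul_volume_ball (hA : MeasurableSet A)
    (hcone : ∀ r : ℝ, 0 < r → ∀ x, r • x ∈ A ↔ x ∈ A) {z : E n} (hz : z ≠ 0) :
    haarO n {g | star (g : E n →L[ℝ] E n) z ∈ A} * volume (ball (0 : E n) 1)
      = volume (A ∩ ball 0 1) := by
  have : Nontrivial (E n) := ⟨z, 0, hz⟩
  have hconst : ∀ᵐ x ∂volume.restrict (ball (0 : E n) 1),
      haarO n {g | star (g : E n →L[ℝ] E n) x ∈ A}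
        = haarO n {g | star (g : E n →L[ℝ] E n) z ∈ A} := by
    filter_upwards [ae_restrict_of_ae (Measure.ae_ne volume (0 : E n))] with x hx
    exact haarO_star_apply_mem_eq_of_cone hcone hx hz
  calc haarO n {g | star (g : E n →L[ℝ] E n) z ∈ A} * volume (ball (0 : E n) 1)
      = ∫⁻ x in ball 0 1, haarO n {g | star (g : E n →L[ℝ] E n) x ∈ A} := by
        rw [lintegral_congr_ae hconst, lintegral_const, Measure.restrict_apply_univ]
    _ = (volume.restrict (ball 0 1)).prod (haarO n)
          {p : E n × O n | star (p.2 : E n →L[ℝ] E n) p.1 ∈ A} :=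
        (Measure.prod_apply (measurableSet_star_apply_mem hA)).symm
    _ = ∫⁻ g, volume.restrict (ball 0 1) {x | star (g : E n →L[ℝ] E n) x ∈ A} ∂haarO n :=
        Measure.prod_apply_symm (measurableSet_star_apply_mem hA)
    _ = volume (A ∩ ball 0 1) := by
        simp only [volume_restrict_ball_star_apply_mem hA, lintegral_const, measure_univ, mul_one]

end OrthogonalGroup

section Grassmannian

variable {n m : ℕ}

instance : SecondCountableTopology (Gr n m) :=
  have : ProperSpace (E n →L[ℝ] E n) := FiniteDimensional.proper ℝ _
  TopologicalSpace.secondCountableTopology_induced _ _ _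

theorem norm_proj (V : Gr n m) (z : E n) : ‖proj V z‖ = ‖V.1.starProjection z‖ := rfl

theorem measurableSet_norm_proj_le (δ : ℝ) :
    MeasurableSet {q : Gr n m × E n | ‖proj q.1 q.2‖ ≤ δ} := by
  have hV : Continuous fun V : Gr n m => V.1.starProjection := continuous_induced_dom
  simp only [norm_proj]
  exact (isClosed_le ((hV.comp continuous_fst).clm_apply continuous_snd).norm
    continuous_const).measurableSet

theorem grMeasure_norm_proj_le (h : m ≤ n) (δ : ℝ) (z : E n) :
    grMeasure h {V | ‖proj V z‖ ≤ δ}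
      = haarO n {g | ‖(coordPlane h).1.starProjection (star (g : E n →L[ℝ] E n) z)‖ ≤ δ} := by
  have hrot (g : O n) : ‖proj (rot g (coordPlane h)) z‖
      = ‖(coordPlane h).1.starProjection (star (g : E n →L[ℝ] E n) z)‖ := by
    rw [norm_proj, starProjection_rot]
    exact (Unitary.linearIsometryEquiv g).norm_map _
  have hS : MeasurableSet {V : Gr n m | ‖proj V z‖ ≤ δ} :=
    measurable_prodMk_right (measurableSet_norm_proj_le δ)
  rw [grMeasure, Measure.map_apply (continuous_rot _).measurable hS]
  simp only [Set.preimage_ofPred_eq, hrot]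

end Grassmannian

section ProjKernel

variable {n m : ℕ}

/-- For `t > 0`, the normalized volume of the part in the unit ball of the cone `‖P x‖ ≤ t ‖x‖`
about the complement of an `m`-plane, stretched by `1 / t` along that plane. Its limit as `t → 0`,
the value at `t = 0`, is the constant relating energies. -/
noncomputable def coneRatio (h : m ≤ n) (t : ℝ) : ℝ≥0∞ :=
  volume (stretchedCone (coordPlane h).1 t)
    / (volume (ball (0 : E n) 1) * volume (ball (0 : E m) 1))

/-- The average over planes `V` of the indicator of `‖P_V z‖ ≤ δ`, divided by the volume of an
`m`-dimensional ball of radius `δ`. As `δ → 0` it becomes a multiple of the Riesz kernel `|z|⁻ᵐ`. -/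
noncomputable def projKernel (h : m ≤ n) (δ : ℝ) (z : E n) : ℝ≥0∞ :=
  grMeasure h {V | ‖proj V z‖ ≤ δ} / volume (closedBall (0 : E m) δ)

theorem volume_ball_zero_one_ne_zero (k : ℕ) : volume (ball (0 : E k) 1) ≠ 0 :=
  (measure_ball_pos volume 0 one_pos).ne'

theorem volume_closedBall_zero {δ : ℝ} (hδ : 0 ≤ δ) :
    volume (closedBall (0 : E m) δ) = ENNReal.ofReal (δ ^ m) * volume (ball (0 : E m) 1) := by
  rw [Measure.addHaar_closedBall _ _ hδ, finrank_euclideanSpace_fin]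

theorem tendsto_volume_closedBall_zero (hm : 0 < m) :
    Tendsto (fun δ => volume (closedBall (0 : E m) δ)) (𝓝[>] 0) (𝓝 0) := by
  have hpow : Tendsto (fun δ : ℝ => ENNReal.ofReal (δ ^ m)) (𝓝[>] 0) (𝓝 0) := by
    have hcont : Continuous fun δ : ℝ => ENNReal.ofReal (δ ^ m) :=
      ENNReal.continuous_ofReal.comp (continuous_pow m)
    simpa [hm.ne'] using (hcont.tendsto 0).mono_left nhdsWithin_le_nhds
  have hmul := ENNReal.Tendsto.mul_const hpow
    (.inr (measure_ball_lt_top (μ := volume) (x := (0 : E m)) (r := 1)).ne)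
  rw [zero_mul] at hmul
  refine hmul.congr' ?_
  filter_upwards [self_mem_nhdsWithin] with δ hδ
  exact (volume_closedBall_zero (Set.mem_Ioi.1 hδ).le).symm

theorem exists_coneRatio_le (h : m ≤ n) : ∃ C : ℝ≥0∞, C ≠ 0 ∧ C ≠ ∞ ∧ ∀ t, coneRatio h t ≤ C := by
  refine ⟨volume (ball (0 : E n) 2) / (volume (ball (0 : E n) 1) * volume (ball (0 : E m) 1)),
    ENNReal.div_ne_zero.2 ⟨(measure_ball_pos volume 0 two_pos).ne',
      ENNReal.mul_ne_top measure_ball_lt_top.ne measure_ball_lt_top.ne⟩,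
    ENNReal.div_ne_top measure_ball_lt_top.ne
      (mul_ne_zero (volume_ball_zero_one_ne_zero n) (volume_ball_zero_one_ne_zero m)), fun t => ?_⟩
  exact ENNReal.div_le_div_right (measure_mono (stretchedCone_subset_ball _ t)) _

theorem tendsto_coneRatio (h : m ≤ n) :
    Tendsto (coneRatio h) (𝓝[>] 0) (𝓝 (coneRatio h 0)) :=
  ENNReal.Tendsto.div_const (tendsto_measure_stretchedCone _ volume)
    (.inr (mul_ne_zero (volume_ball_zero_one_ne_zero n) (volume_ball_zero_one_ne_zero m)))

theorem grMeasure_norm_proj_le_mul_volume_ball (h : m ≤ n) {t : ℝ} (ht : 0 < t) {z : E n}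
    (hz : z ≠ 0) :
    grMeasure h {V | ‖proj V z‖ ≤ t * ‖z‖} * volume (ball (0 : E n) 1)
      = ENNReal.ofReal (t ^ m) * volume (stretchedCone (coordPlane h).1 t) := by
  let A : Set (E n) := {x | ‖(coordPlane h).1.starProjection x‖ ≤ t * ‖x‖}
  have hA : MeasurableSet A := (isClosed_le (by fun_prop) (by fun_prop)).measurableSet
  have hcone : ∀ r : ℝ, 0 < r → ∀ x, r • x ∈ A ↔ x ∈ A := fun r hr x => by
    simp only [A, Set.mem_ofPred_eq, map_smul, norm_smul, mul_left_comm t,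
      mul_le_mul_iff_right₀ (norm_pos_iff.2 hr.ne')]
  have hnorm (g : O n) : ‖star (g : E n →L[ℝ] E n) z‖ = ‖z‖ :=
    (Unitary.linearIsometryEquiv (star g)).norm_map z
  have hcoord := addHaar_cone_inter_ball (coordPlane h).1 volume ht
  rw [(coordPlane h).2] at hcoord
  rw [← hcoord, ← haarO_star_apply_mem_mul_volume_ball hA hcone hz, grMeasure_norm_proj_le]
  simp only [A, Set.mem_ofPred_eq, hnorm]

theorem projKernel_eq (h : m ≤ n) {δ : ℝ} (hδ : 0 < δ) {z : E n} (hz : z ≠ 0) :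
    projKernel h δ z = ‖z‖ₑ ^ (-(m : ℝ)) * coneRatio h (δ / ‖z‖) := by
  have hnorm : 0 < ‖z‖ := norm_pos_iff.2 hz
  have hpow : ENNReal.ofReal ((δ / ‖z‖) ^ m) = ENNReal.ofReal (δ ^ m) * ‖z‖ₑ ^ (-(m : ℝ)) := by
    rw [← ofReal_norm, ENNReal.ofReal_rpow_of_pos hnorm, Real.rpow_neg hnorm.le,
      Real.rpow_natCast, ← ENNReal.ofReal_mul (by positivity), div_pow, div_eq_mul_inv]
  have hmeas := grMeasure_norm_proj_le_mul_volume_ball h (div_pos hδ hnorm) hz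
  rw [div_mul_cancel₀ _ hnorm.ne', hpow] at hmeas
  have hδ0 : ENNReal.ofReal (δ ^ m) ≠ 0 := (ENNReal.ofReal_pos.2 (pow_pos hδ m)).ne'
  rw [projKernel, coneRatio, volume_closedBall_zero hδ.le,
    (ENNReal.eq_div_iff (volume_ball_zero_one_ne_zero n) measure_ball_lt_top.ne).2
      ((mul_comm _ _).trans hmeas)]
  simp only [div_eq_mul_inv]
  rw [ENNReal.mul_inv (.inl hδ0) (.inl ENNReal.ofReal_ne_top),
    ENNReal.mul_inv (.inl (volume_ball_zero_one_ne_zero n)) (.inl measure_ball_lt_top.ne),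
    ← one_mul (‖z‖ₑ ^ (-(m : ℝ)) * _), ← ENNReal.mul_inv_cancel hδ0 ENNReal.ofReal_ne_top]
  ring

theorem projKernel_zero_right (h : m ≤ n) {δ : ℝ} (hδ : 0 ≤ δ) :
    projKernel h δ 0 = (volume (closedBall (0 : E m) δ))⁻¹ := by
  simp only [projKernel, map_zero, norm_zero, hδ, Set.ofPred_true, measure_univ, one_div]

theorem projKernel_eq_coneRatio_of_dim_zero (h : 0 ≤ n) {δ : ℝ} (hδ : 0 ≤ δ) (t : ℝ) :
    projKernel h δ 0 = coneRatio h t := by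
  have hbot : (coordPlane h).1 = ⊥ := Submodule.finrank_eq_zero.1 (coordPlane h).2
  have hcone : stretchedCone (coordPlane h).1 t = ball 0 1 := by
    ext y
    simp [hbot, stretchedCone, stretch_apply, Submodule.starProjection_top]
  rw [projKernel_zero_right h hδ, volume_closedBall_zero hδ, pow_zero, ENNReal.ofReal_one, one_mul,
    coneRatio, hcone, ← one_div, ← ENNReal.mul_div_mul_left 1 _ (volume_ball_zero_one_ne_zero n)
      measure_ball_lt_top.ne, mul_one]

theorem exists_projKernel_le (h : m ≤ n) :
    ∃ C : ℝ≥0∞, C ≠ ∞ ∧ ∀ δ : ℝ, 0 < δ → ∀ z, projKernel h δ z ≤ C * ‖z‖ₑ ^ (-(m : ℝ)) := by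
  obtain ⟨C, hC0, hC, hle⟩ := exists_coneRatio_le h
  refine ⟨C, hC, fun δ hδ z => ?_⟩
  rcases eq_or_ne z 0 with rfl | hz
  · rcases m.eq_zero_or_pos with rfl | hm
    · simpa [projKernel_eq_coneRatio_of_dim_zero h hδ.le 0] using hle 0
    · simp [ENNReal.zero_rpow_of_neg, hm, ENNReal.mul_top hC0]
  · rw [projKernel_eq h hδ hz, mul_comm]
    gcongr
    exact hle _

theorem tendsto_projKernel (h : m ≤ n) {z : E n}
    (hz : coneRatio h 0 ≠ 0 ∨ ‖z‖ₑ ^ (-(m : ℝ)) ≠ ∞) :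
    Tendsto (fun δ => projKernel h δ z) (𝓝[>] 0) (𝓝 (coneRatio h 0 * ‖z‖ₑ ^ (-(m : ℝ)))) := by
  rcases eq_or_ne z 0 with rfl | hz0
  · rcases m.eq_zero_or_pos with rfl | hm
    · refine tendsto_const_nhds.congr' ?_
      filter_upwards [self_mem_nhdsWithin] with δ hδ
      rw [projKernel_eq_coneRatio_of_dim_zero h (Set.mem_Ioi.1 hδ).le 0]
      simp
    · have htop : ‖(0 : E n)‖ₑ ^ (-(m : ℝ)) = ∞ := by
        simp [ENNReal.zero_rpow_of_neg, hm]
      rw [htop, ENNReal.mul_top (hz.resolve_right (not_not.2 htop)), ← ENNReal.inv_zero]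
      refine (tendsto_volume_closedBall_zero hm).inv.congr' ?_
      filter_upwards [self_mem_nhdsWithin] with δ hδ
      exact (projKernel_zero_right h (Set.mem_Ioi.1 hδ).le).symm
  · have hdiv : Tendsto (fun δ => δ / ‖z‖) (𝓝[>] 0) (𝓝[>] 0) := by
      refine tendsto_nhdsWithin_iff.2 ⟨?_, ?_⟩
      · simpa using (tendsto_id.div_const ‖z‖).mono_left (nhdsWithin_le_nhds (a := (0 : ℝ)))
      · filter_upwards [self_mem_nhdsWithin] with δ hδ
        exact div_pos hδ (norm_pos_iff.2 hz0)
    have hne : ‖z‖ₑ ^ (-(m : ℝ)) ≠ ∞ :=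
      ENNReal.rpow_ne_top_of_ne_zero (by simpa using hz0) (by simp)
    rw [mul_comm]
    refine (ENNReal.Tendsto.const_mul ((tendsto_coneRatio h).comp hdiv) (.inr hne)).congr' ?_
    filter_upwards [self_mem_nhdsWithin] with δ hδ using (projKernel_eq h hδ hz0).symm

end ProjKernel

section Planes

variable {n m : ℕ}

theorem hausV_eq_volume (V : Gr n m) : hausV V = volume := by
  have hvol := InnerProductSpace.euclideanHausdorffMeasure_eq_volume (V := V.1)
  rwa [V.2] at hvol

instance (V : Gr n m) : (hausV V).IsAddHaarMeasure := by
  rw [hausV_eq_volume]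
  infer_instance

theorem hausV_closedBall (V : Gr n m) (v : V.1) (δ : ℝ) :
    hausV V (closedBall v δ) = volume (closedBall (0 : E m) δ) := by
  let e := ((stdOrthonormalBasis ℝ V.1).reindex (finCongr V.2)).repr
  rw [Measure.addHaar_closedBall_center, hausV_eq_volume,
    ← e.measurePreserving.measure_preimage measurableSet_closedBall.nullMeasurableSet,
    e.preimage_closedBall, map_zero]

theorem measurable_proj (V : Gr n m) : Measurable (proj V) := (proj V).continuous.measurable

instance (V : Gr n m) (μ : Measure (E n)) [IsFiniteMeasure μ] :
    IsFiniteMeasure (projMeasure V μ) := by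
  unfold projMeasure
  infer_instance

theorem projMeasure_add (V : Gr n m) (μ ν : Measure (E n)) :
    projMeasure V (μ + ν) = projMeasure V μ + projMeasure V ν :=
  Measure.map_add _ _ (measurable_proj V)

variable (μ ν : Measure (E n)) [IsFiniteMeasure μ]

theorem measurableSet_norm_proj_sub_le (δ : ℝ) :
    MeasurableSet {q : Gr n m × (E n × E n) | ‖proj q.1 (q.2.2 - q.2.1)‖ ≤ δ} :=
  (by fun_prop : Measurable fun q : Gr n m × (E n × E n) => (q.1, q.2.2 - q.2.1))
    (measurableSet_norm_proj_le δ)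

theorem ballEnergy_projMeasure (V : Gr n m) (δ : ℝ) :
    ballEnergy (hausV V) δ (projMeasure V μ) (projMeasure V ν)
      = ν.prod μ {p | ‖proj V (p.2 - p.1)‖ ≤ δ} / volume (closedBall (0 : E m) δ) := by
  have hball := measurable_measure_closedBall (projMeasure V μ) δ
  have hS : MeasurableSet {p : E n × E n | ‖proj V (p.2 - p.1)‖ ≤ δ} :=
    measurable_prodMk_left (measurableSet_norm_proj_sub_le δ)
  simp only [ballEnergy, hausV_closedBall, div_eq_mul_inv]
  rw [lintegral_mul_const _ hball, Measure.prod_apply hS]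
  congr 1
  refine (lintegral_map hball (measurable_proj V)).trans (lintegral_congr fun y => ?_)
  rw [projMeasure, Measure.map_apply (measurable_proj V) measurableSet_closedBall]
  simp only [Set.preimage, mem_closedBall, dist_eq_norm, map_sub, Set.mem_ofPred_eq]

variable [IsFiniteMeasure ν]

theorem measurable_ballEnergy_projMeasure (δ : ℝ) :
    Measurable fun V : Gr n m => ballEnergy (hausV V) δ (projMeasure V μ) (projMeasure V ν) := by
  simp only [ballEnergy_projMeasure]
  exact (measurable_measure_prodMk_left (measurableSet_norm_proj_sub_le δ)).div_const _

theorem measurable_projKernel (h : m ≤ n) (δ : ℝ) : Measurable (projKernel h δ) :=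
  (measurable_measure_prodMk_right (measurableSet_norm_proj_le δ)).div_const _

theorem lintegral_ballEnergy_projMeasure (h : m ≤ n) (δ : ℝ) :
    ∫⁻ V, ballEnergy (hausV V) δ (projMeasure V μ) (projMeasure V ν) ∂grMeasure h
      = ∫⁻ p, projKernel h δ (p.2 - p.1) ∂ν.prod μ := by
  have hS := measurableSet_norm_proj_sub_le (n := n) (m := m) δ
  have hV : Measurable fun V : Gr n m => ν.prod μ {p | ‖proj V (p.2 - p.1)‖ ≤ δ} :=
    measurable_measure_prodMk_left hS
  have hp : Measurable fun p : E n × E n => grMeasure h {V | ‖proj V (p.2 - p.1)‖ ≤ δ} :=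
    measurable_measure_prodMk_right hS
  simp only [ballEnergy_projMeasure, projKernel, div_eq_mul_inv]
  rw [lintegral_mul_const _ hV, lintegral_mul_const _ hp]
  congr 1
  exact (Measure.prod_apply hS).symm.trans (Measure.prod_apply_symm hS)

end Planes

section RieszEnergy

variable {n : ℕ} (s : ℝ)

theorem measurable_edist_rpow : Measurable fun p : E n × E n => edist p.2 p.1 ^ (-s) :=
  (by fun_prop : Measurable fun p : E n × E n => edist p.2 p.1).pow_const _

theorem mutualEnergy_pos {s : ℝ} {μ ν : Measure (E n)} [SFinite μ] (hs : 0 ≤ s) (hμ : μ ≠ 0)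
    (hν : ν ≠ 0) : 0 < mutualEnergy s μ ν := by
  have : NeZero μ := ⟨hμ⟩
  have : NeZero ν := ⟨hν⟩
  have hmeas := measurable_edist_rpow (n := n) s
  refine pos_iff_ne_zero.2 fun hzero => ?_
  obtain ⟨y, hy⟩ := ((lintegral_eq_zero_iff hmeas.lintegral_prod_right').1 hzero).exists
  obtain ⟨x, hx⟩ := ((lintegral_eq_zero_iff (hmeas.comp measurable_prodMk_left)).1 hy).exists
  rw [Pi.zero_apply, Function.comp_apply, ENNReal.rpow_neg, ENNReal.inv_eq_zero] at hx
  exact ENNReal.rpow_ne_top_of_nonneg hs (edist_ne_top _ _) hx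

variable (μ ν : Measure (E n)) [SFinite μ]

theorem mutualEnergy_eq_lintegral_prod :
    mutualEnergy s μ ν = ∫⁻ p, edist p.2 p.1 ^ (-s) ∂ν.prod μ :=
  (lintegral_prod _ (measurable_edist_rpow s).aemeasurable).symm

theorem lintegral_const_mul_enorm_sub_rpow (C : ℝ≥0∞) :
    ∫⁻ p, C * ‖p.2 - p.1‖ₑ ^ (-s) ∂ν.prod μ = C * mutualEnergy s μ ν := by
  simp only [← edist_eq_enorm_sub]
  rw [lintegral_const_mul _ (measurable_edist_rpow s), mutualEnergy_eq_lintegral_prod]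

variable [SFinite ν]

theorem mutualEnergy_comm : mutualEnergy s μ ν = mutualEnergy s ν μ := by
  rw [mutualEnergy, lintegral_lintegral_swap (measurable_edist_rpow s).aemeasurable, mutualEnergy]
  simp only [edist_comm]

theorem energy_add :
    energy s (μ + ν) = energy s μ + energy s ν + 2 * mutualEnergy s μ ν := by
  have hμ : Measurable fun y : E n => ∫⁻ x, edist x y ^ (-s) ∂μ :=
    (measurable_edist_rpow s).lintegral_prod_right'
  have hcomm := mutualEnergy_comm s ν μ
  simp only [mutualEnergy] at hcomm
  simp only [energy, mutualEnergy, lintegral_add_measure]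
  rw [lintegral_add_left hμ, lintegral_add_left hμ, hcomm]
  ring

end RieszEnergy

section GrEnergy

variable {n m : ℕ}

theorem measurable_densityEnergy_projMeasure (μ : Measure (E n)) [IsFiniteMeasure μ] :
    Measurable fun V : Gr n m => densityEnergy (hausV V) (projMeasure V μ) :=
  measurable_of_tendsto_metrizable' (𝓝[>] (0 : ℝ)) (measurable_ballEnergy_projMeasure μ μ)
    (tendsto_pi_nhds.2 fun V => tendsto_ballEnergy (hausV V) (projMeasure V μ))

/-- The integral over all `m`-planes of the squared `L²` norm of the density of the projection of
`μ`, infinite if `P_{V♯} μ` is singular for positively many `V`. -/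
noncomputable def grEnergy (h : m ≤ n) (μ : Measure (E n)) : ℝ≥0∞ :=
  ∫⁻ V, densityEnergy (hausV V) (projMeasure V μ) ∂grMeasure h

variable (h : m ≤ n) (μ ν : Measure (E n)) [IsFiniteMeasure μ] [IsFiniteMeasure ν]

theorem lintegral_projKernel_self_le (δ : ℝ) :
    ∫⁻ p, projKernel h δ (p.2 - p.1) ∂μ.prod μ ≤ grEnergy h μ := by
  rw [← lintegral_ballEnergy_projMeasure]
  exact lintegral_mono fun V => ballEnergy_self_le fun v => hausV_closedBall V v δ

theorem two_mul_lintegral_projKernel_le (δ : ℝ) :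
    2 * ∫⁻ p, projKernel h δ (p.2 - p.1) ∂ν.prod μ ≤ grEnergy h μ + grEnergy h ν := by
  rw [← lintegral_ballEnergy_projMeasure,
    ← lintegral_const_mul _ (measurable_ballEnergy_projMeasure μ ν δ), grEnergy, grEnergy,
    ← lintegral_add_left (measurable_densityEnergy_projMeasure μ)]
  exact lintegral_mono fun V => two_mul_ballEnergy_le fun v => hausV_closedBall V v δ

theorem tendsto_lintegral_projKernel_grEnergy :
    Tendsto (fun δ => ∫⁻ p, projKernel h δ (p.2 - p.1) ∂μ.prod μ) (𝓝[>] 0)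
      (𝓝 (grEnergy h μ)) := by
  refine tendsto_of_le_liminf_of_limsup_le ?_ (limsup_le_of_le (by isBoundedDefault)
    (Eventually.of_forall (lintegral_projKernel_self_le h μ)))
  simp only [← lintegral_ballEnergy_projMeasure]
  exact (lintegral_mono fun V => densityEnergy_le_liminf_ballEnergy _ _).trans
    (lintegral_liminf_le (measurable_ballEnergy_projMeasure μ μ))

theorem measurable_projKernel_sub (δ : ℝ) :
    Measurable fun p : E n × E n => projKernel h δ (p.2 - p.1) :=
  (measurable_projKernel h δ).comp (measurable_snd.sub measurable_fst)

variable {μ ν}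

theorem grEnergy_eq (hμ : energy m μ ≠ ∞) : grEnergy h μ = coneRatio h 0 * energy m μ := by
  obtain ⟨C, hC, hle⟩ := exists_projKernel_le h
  have hfin : ∀ᵐ p ∂μ.prod μ, ‖p.2 - p.1‖ₑ ^ (-(m : ℝ)) < ∞ := by
    rw [energy, mutualEnergy_eq_lintegral_prod] at hμ
    simpa only [edist_eq_enorm_sub] using ae_lt_top (measurable_edist_rpow m) hμ
  refine tendsto_nhds_unique (tendsto_lintegral_projKernel_grEnergy h μ) ?_
  rw [energy, ← lintegral_const_mul_enorm_sub_rpow]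
  refine tendsto_lintegral_filter_of_dominated_convergence
    (fun p => C * ‖p.2 - p.1‖ₑ ^ (-(m : ℝ)))
    (Eventually.of_forall (measurable_projKernel_sub h)) ?_ ?_ ?_
  · filter_upwards [self_mem_nhdsWithin] with δ hδ
    exact Eventually.of_forall fun p => hle δ hδ _
  · rw [lintegral_const_mul_enorm_sub_rpow]
    exact ENNReal.mul_ne_top hC hμ
  · filter_upwards [hfin] with p hp using tendsto_projKernel h (.inr hp.ne)

theorem grEnergy_ne_top (hμ : energy m μ ≠ ∞) : grEnergy h μ ≠ ∞ := by
  obtain ⟨C, -, hC, hle⟩ := exists_coneRatio_le h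
  rw [grEnergy_eq h hμ]
  exact ENNReal.mul_ne_top ((hle 0).trans_lt hC.lt_top).ne hμ

theorem grEnergy_ne_zero (hμ : μ ≠ 0) : grEnergy h μ ≠ 0 := by
  intro hzero
  rw [grEnergy, lintegral_eq_zero_iff (measurable_densityEnergy_projMeasure μ)] at hzero
  obtain ⟨V, hV⟩ := hzero.exists
  have hproj := eq_zero_of_densityEnergy_eq_zero hV
  rw [projMeasure, Measure.map_eq_zero_iff (measurable_proj V).aemeasurable] at hproj
  exact hμ hproj

theorem coneRatio_zero_ne_zero (hμ : energy m μ ≠ ∞) (hμ0 : μ ≠ 0) : coneRatio h 0 ≠ 0 := by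
  intro hzero
  apply grEnergy_ne_zero h hμ0
  rw [grEnergy_eq h hμ, hzero, zero_mul]

theorem two_mul_mutualEnergy_le (hC : coneRatio h 0 ≠ 0) :
    2 * (coneRatio h 0 * mutualEnergy m μ ν) ≤ grEnergy h μ + grEnergy h ν := by
  have hlim (p : E n × E n) : liminf (fun δ => projKernel h δ (p.2 - p.1)) (𝓝[>] 0)
      = coneRatio h 0 * ‖p.2 - p.1‖ₑ ^ (-(m : ℝ)) :=
    (tendsto_projKernel h (.inl hC)).liminf_eq
  rw [mul_comm, ← ENNReal.le_div_iff_mul_le (.inl two_ne_zero) (.inl ENNReal.ofNat_ne_top),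
    ← lintegral_const_mul_enorm_sub_rpow]
  simp only [← hlim]
  refine (lintegral_liminf_le (measurable_projKernel_sub h)).trans
    (liminf_le_of_frequently_le' (Eventually.of_forall fun δ => ?_).frequently)
  rw [ENNReal.le_div_iff_mul_le (.inl two_ne_zero) (.inl ENNReal.ofNat_ne_top), mul_comm]
  exact two_mul_lintegral_projKernel_le h μ ν δ

theorem mutualEnergy_ne_top (hC : coneRatio h 0 ≠ 0) (hμ : energy m μ ≠ ∞) (hν : energy m ν ≠ ∞) :
    mutualEnergy m μ ν ≠ ∞ := by
  intro htop
  have hle := two_mul_mutualEnergy_le h (μ := μ) (ν := ν) hC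
  rw [htop, ENNReal.mul_top hC, ENNReal.mul_top two_ne_zero, top_le_iff] at hle
  exact ENNReal.add_ne_top.2 ⟨grEnergy_ne_top h hμ, grEnergy_ne_top h hν⟩ hle

end GrEnergy

section Polarization

variable {n m : ℕ} {h : m ≤ n} {μ ν : Measure (E n)} [IsFiniteMeasure μ] [IsFiniteMeasure ν]

theorem ae_projMeasure_absolutelyContinuous (hμ : grEnergy h μ ≠ ∞) :
    ∀ᵐ V ∂grMeasure h, projMeasure V μ ≪ hausV V := by
  filter_upwards [ae_lt_top (measurable_densityEnergy_projMeasure μ) hμ] with V hV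
  exact absolutelyContinuous_of_densityEnergy_ne_top hV.ne

theorem ae_densityEnergy_projMeasure_add (hμ : grEnergy h μ ≠ ∞) (hν : grEnergy h ν ≠ ∞) :
    ∀ᵐ V ∂grMeasure h, densityEnergy (hausV V) (projMeasure V (μ + ν))
      = densityEnergy (hausV V) (projMeasure V μ) + densityEnergy (hausV V) (projMeasure V ν)
        + 2 * ∫⁻ v, projDensity V μ v * projDensity V ν v ∂hausV V := by
  filter_upwards [ae_projMeasure_absolutelyContinuous hμ,
    ae_projMeasure_absolutelyContinuous hν] with V hVμ hVν
  rw [projMeasure_add]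
  exact densityEnergy_add hVμ hVν

theorem aemeasurable_lintegral_projDensity_mul (hμ : grEnergy h μ ≠ ∞) (hν : grEnergy h ν ≠ ∞) :
    AEMeasurable (fun V : Gr n m => ∫⁻ v, projDensity V μ v * projDensity V ν v ∂hausV V)
      (grMeasure h) := by
  have hmeas (κ : Measure (E n)) [IsFiniteMeasure κ] :=
    measurable_densityEnergy_projMeasure (m := m) κ
  refine ⟨_, ((hmeas (μ + ν)).sub ((hmeas μ).add (hmeas ν))).div_const 2, ?_⟩
  filter_upwards [ae_densityEnergy_projMeasure_add hμ hν, ae_lt_top (hmeas μ) hμ,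
    ae_lt_top (hmeas ν) hν] with V hadd hVμ hVν
  rw [Pi.sub_apply, hadd, Pi.add_apply,
    ENNReal.add_sub_cancel_left (ENNReal.add_ne_top.2 ⟨hVμ.ne, hVν.ne⟩),
    mul_div_assoc, ENNReal.mul_div_cancel two_ne_zero ENNReal.ofNat_ne_top]

theorem grEnergy_add (hμ : grEnergy h μ ≠ ∞) (hν : grEnergy h ν ≠ ∞) :
    grEnergy h (μ + ν) = grEnergy h μ + grEnergy h ν
      + 2 * ∫⁻ V, ∫⁻ v, projDensity V μ v * projDensity V ν v ∂hausV V ∂grMeasure h := by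
  have hmeas (κ : Measure (E n)) [IsFiniteMeasure κ] :=
    measurable_densityEnergy_projMeasure (m := m) κ
  rw [grEnergy, lintegral_congr_ae (ae_densityEnergy_projMeasure_add hμ hν),
    lintegral_add_left ((hmeas μ).fun_add (hmeas ν)), lintegral_add_left (hmeas μ),
    lintegral_const_mul'' _ (aemeasurable_lintegral_projDensity_mul hμ hν), grEnergy, grEnergy]

theorem lintegral_projDensity_mul_eq (hC : coneRatio h 0 ≠ 0) (hμ : energy m μ ≠ ∞)
    (hν : energy m ν ≠ ∞) :
    ∫⁻ V, ∫⁻ v, projDensity V μ v * projDensity V ν v ∂hausV V ∂grMeasure h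
      = coneRatio h 0 * mutualEnergy m μ ν := by
  have hgμ := grEnergy_ne_top h hμ
  have hgν := grEnergy_ne_top h hν
  have hsum : energy m (μ + ν) ≠ ∞ := by
    rw [energy_add]
    exact ENNReal.add_ne_top.2 ⟨ENNReal.add_ne_top.2 ⟨hμ, hν⟩,
      ENNReal.mul_ne_top ENNReal.ofNat_ne_top (mutualEnergy_ne_top h hC hμ hν)⟩
  have hpolar := grEnergy_add hgμ hgν
  rw [grEnergy_eq h hsum, energy_add, mul_add, mul_add, ← grEnergy_eq h hμ, ← grEnergy_eq h hν,
    ENNReal.add_right_inj (ENNReal.add_ne_top.2 ⟨hgμ, hgν⟩), mul_left_comm,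
    ENNReal.mul_right_inj two_ne_zero ENNReal.ofNat_ne_top] at hpolar
  exact hpolar.symm

end Polarization

section Supports

variable {X Y : Type*} [TopologicalSpace X] [SigmaCompactSpace X] [TopologicalSpace Y] [T2Space Y]
  [MeasurableSpace Y] [BorelSpace Y]

theorem measurableSet_image_of_isClosed {f : X → Y} (hf : Continuous f) {s : Set X}
    (hs : IsClosed s) : MeasurableSet (f '' s) := by
  obtain ⟨K, hK, hunion⟩ :=
    (isSigmaCompact_univ.of_isClosed_subset hs (Set.subset_univ s)).image hf
  rw [← hunion]
  exact .iUnion fun i => (hK i).measurableSet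

variable {n m : ℕ} {μ ν : Measure (E n)}

theorem measurableSet_proj_image_support (V : Gr n m) (μ : Measure (E n)) :
    MeasurableSet (proj V '' μ.support) :=
  measurableSet_image_of_isClosed (proj V).continuous Measure.isClosed_support

theorem projMeasure_compl_image_support (V : Gr n m) (μ : Measure (E n)) :
    projMeasure V μ (proj V '' μ.support)ᶜ = 0 := by
  rw [projMeasure,
    Measure.map_apply (measurable_proj V) (measurableSet_proj_image_support V μ).compl]
  exact measure_mono_null (fun x hx hxs => hx ⟨x, hxs, rfl⟩) Measure.measure_compl_support

theorem grMeasure_inter_supports_pos {h : m ≤ n}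
    (hpos : 0 < ∫⁻ V, ∫⁻ v, projDensity V μ v * projDensity V ν v ∂hausV V ∂grMeasure h) :
    0 < grMeasure h {V | 0 < hausV V (proj V '' μ.support ∩ proj V '' ν.support)} := by
  refine pos_iff_ne_zero.2 fun hzero => hpos.ne' ((lintegral_congr_ae ?_).trans lintegral_zero)
  filter_upwards [measure_eq_zero_iff_ae_notMem.1 hzero] with V hV
  exact lintegral_rnDeriv_mul_rnDeriv_eq_zero (measurableSet_proj_image_support V μ)
    (measurableSet_proj_image_support V ν) (projMeasure_compl_image_support V μ)
    (projMeasure_compl_image_support V ν) (nonpos_iff_eq_zero.1 (not_lt.1 hV))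

end Supports

theorem MemM.isFiniteMeasure {n : ℕ} {μ : Measure (E n)} (hμ : MemM Set.univ μ) :
    IsFiniteMeasure μ := ⟨hμ.2.1⟩

theorem MemM.ne_zero {n : ℕ} {A : Set (E n)} {μ : Measure (E n)} (hμ : MemM A μ) : μ ≠ 0 := by
  rintro rfl
  exact hμ.1.ne' rfl

end IntProj

open IntProj in
theorem mainTheorem5_general (n m : ℕ) (hmn : m ≤ n) :
    ∃ c : ℝ≥0∞, 0 < c ∧ c < ∞ ∧
      ∀ (μ ν : Measure (E n)) [IsFiniteMeasure μ] [IsFiniteMeasure ν], μ ≠ 0 → ν ≠ 0 →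
        energy (m : ℝ) μ < ∞ → energy (m : ℝ) ν < ∞ →
        (∀ᵐ V ∂grMeasure hmn, projMeasure V μ ≪ hausV V ∧ projMeasure V ν ≪ hausV V) ∧
        AEMeasurable
          (fun V : Gr n m => ∫⁻ v, projDensity V μ v * projDensity V ν v ∂hausV V)
          (grMeasure hmn) ∧
        0 < ∫⁻ V, ∫⁻ v, projDensity V μ v * projDensity V ν v ∂hausV V ∂grMeasure hmn ∧
        ∫⁻ V, ∫⁻ v, projDensity V μ v * projDensity V ν v ∂hausV V ∂grMeasure hmn < ∞ ∧
        ∫⁻ V, ∫⁻ v, projDensity V μ v * projDensity V ν v ∂hausV V ∂grMeasure hmn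
          = c * mutualEnergy (m : ℝ) μ ν ∧
        0 < grMeasure hmn
          {V | 0 < hausV V (proj V '' μ.support ∩ proj V '' ν.support)} := by
  obtain ⟨C, -, hC, hle⟩ := exists_coneRatio_le hmn
  have hfin : coneRatio hmn 0 < ∞ := (hle 0).trans_lt hC.lt_top
  by_cases hpos : coneRatio hmn 0 = 0
  -- This is the case `m = n > 0`, where no nonzero measure has finite energy.
  · exact ⟨1, one_pos, ENNReal.one_lt_top, fun μ ν _ _ hμ _ hEμ _ =>
      (coneRatio_zero_ne_zero hmn hEμ.ne hμ hpos).elim⟩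
  refine ⟨coneRatio hmn 0, pos_iff_ne_zero.2 hpos, hfin, fun μ ν _ _ hμ hν hEμ hEν => ?_⟩
  have hgμ := grEnergy_ne_top hmn hEμ.ne
  have hgν := grEnergy_ne_top hmn hEν.ne
  have heq := lintegral_projDensity_mul_eq hpos hEμ.ne hEν.ne
  have hIpos : 0 < coneRatio hmn 0 * mutualEnergy m μ ν :=
    ENNReal.mul_pos hpos (mutualEnergy_pos (Nat.cast_nonneg m) hμ hν).ne'
  exact ⟨(ae_projMeasure_absolutelyContinuous hgμ).and (ae_projMeasure_absolutelyContinuous hgν),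
    aemeasurable_lintegral_projDensity_mul hgμ hgν, hIpos.trans_eq heq.symm,
    heq.trans_lt (ENNReal.mul_lt_top hfin (mutualEnergy_ne_top hmn hpos hEμ.ne hEν.ne).lt_top),
    heq, grMeasure_inter_supports_pos (hIpos.trans_eq heq.symm)⟩

theorem mainTheorem5 (n m : ℕ) (hmn : m ≤ n) :
    ∃ c : ℝ≥0∞, 0 < c ∧ c < ∞ ∧
      ∀ μ ν : Measure (IntProj.E n),
        IntProj.MemM Set.univ μ → IntProj.MemM Set.univ ν →
        IntProj.energy (m : ℝ) μ < ∞ → IntProj.energy (m : ℝ) ν < ∞ →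
        -- for almost every `V` both image measures are functions on `V`
        (∀ᵐ V ∂(IntProj.grMeasure hmn),
          IntProj.projMeasure V μ ≪ IntProj.hausV V ∧
          IntProj.projMeasure V ν ≪ IntProj.hausV V) ∧
        -- the double integral is well defined, finite and positive
        AEMeasurable
          (fun V : IntProj.Gr n m =>
            ∫⁻ v, IntProj.projDensity V μ v * IntProj.projDensity V ν v ∂(IntProj.hausV V))
          (IntProj.grMeasure hmn) ∧
        0 < ∫⁻ V, ∫⁻ v, IntProj.projDensity V μ v * IntProj.projDensity V ν v
            ∂(IntProj.hausV V) ∂(IntProj.grMeasure hmn) ∧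
        ∫⁻ V, ∫⁻ v, IntProj.projDensity V μ v * IntProj.projDensity V ν v
            ∂(IntProj.hausV V) ∂(IntProj.grMeasure hmn) < ∞ ∧
        -- it is a constant multiple of the mutual energy
        ∫⁻ V, ∫⁻ v, IntProj.projDensity V μ v * IntProj.projDensity V ν v
            ∂(IntProj.hausV V) ∂(IntProj.grMeasure hmn)
          = c * IntProj.mutualEnergy (m : ℝ) μ ν ∧
        -- positively many projections of the supports meet in positive measure
        0 < IntProj.grMeasure hmn
          {V | 0 < IntProj.hausV V
            (IntProj.proj V '' μ.support ∩ IntProj.proj V '' ν.support)} := by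
  obtain ⟨c, hc0, hc, hmain⟩ := mainTheorem5_general n m hmn
  exact ⟨c, hc0, hc, fun μ ν hμ hν =>
    have := hμ.isFiniteMeasure
    have := hν.isFiniteMeasure
    hmain μ ν hμ.ne_zero hν.ne_zero⟩
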